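/- Let $\Bbbk$ be a field, let $H$ be a Hopf algebra over $\Bbbk$ (the antipode is not assumed to be bijective), and let $C$ be an $H$-bimodule coalgebra, that is, a coalgebra in the monoidal category of $H$-bimodules, with left action $\triangleright$ and right action $\triangleleft$ of $H$. Let $\mathscr{YD}^C_H$ be the category of Yetter–Drinfeld modules: an object is a right $H$-module $M$ equipped with a right $C$-comodule structure $m \mapsto m_{(0)} \otimes m_{(1)}$ such that $$(m h_{(2)})_{(0)} \otimes h_{(1)} \triangleright (m h_{(2)})_{(1)} = m_{(0)} h_{(1)} \otimes m_{(1)} \triangleleft h_{(2)} \qquad (h \in H,\ m \in M),$$ and a morphism is a right $H$-linear and right $C$-colinear map. Let ${}^H_H\mathfrak{M}^C_H$ be the category of $H$-$C$-bicomodules in the monoidal category of $H$-bimodules: an object is an $H$-bimodule $M$ with a structure of an $H$-$C$-bicomodule whose coactions $M \to H \otimes M$ and $M \to M \otimes C$ are homomorphisms of $H$-bimodules, where $H$ acts on tensor products diagonally through its comultiplication, and a morphism is a left and right $H$-linear, left $H$-colinear and right $C$-colinear map. Then $\mathscr{YD}^C_H$ and ${}^H_H\mathfrak{M}^C_H$ are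 equivalent as $\Bbbk$-linear categories. -/

import Mathlib

open CategoryTheory
open scoped TensorProduct

universe u

namespace HopfYD

section Actions

variable (k H M : Type*) [Field k] [Ring H] [Algebra k H] [AddCommGroup M] [Module k M]

/-- The left action of a `k`-algebra `H` on a left `H`-module `M`, as the `k`-bilinear map
`(h, m) ↦ h m`. -/
def lact [Module H M] [IsScalarTower k H M] : H →ₗ[k] M →ₗ[k] M :=
  (Algebra.lsmul k k M : H →ₐ[k] Module.End k M).toLinearMap

/-- The right action of a `k`-algebra `H` on a right `H`-module `M`, as the `k`-bilinear map
`(h, m) ↦ m h`. Right `H`-modules are modules over the opposite ring `Hᵐᵒᵖ`. -/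
def ract [Module Hᵐᵒᵖ M] [IsScalarTower k Hᵐᵒᵖ M] : H →ₗ[k] M →ₗ[k] M :=
  (Algebra.lsmul k k M : Hᵐᵒᵖ →ₐ[k] Module.End k M).toLinearMap ∘ₗ
    (MulOpposite.opLinearEquiv k : H ≃ₗ[k] Hᵐᵒᵖ).toLinearMap

@[simp]
theorem lact_apply [Module H M] [IsScalarTower k H M] (h : H) (m : M) :
    lact k H M h m = h • m := rfl

@[simp]
theorem ract_apply [Module Hᵐᵒᵖ M] [IsScalarTower k Hᵐᵒᵖ M] (h : H) (m : M) :
    ract k H M h m = MulOpposite.op h • m := rfl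

end Actions

section Comodules

/-- A right comodule `M` over the `k`-coalgebra `C`, with coaction `m ↦ m₍₀₎ ⊗ m₍₁₎`. -/
class RightComodule (k C M : Type*) [Field k] [AddCommGroup C] [Module k C] [Coalgebra k C]
    [AddCommGroup M] [Module k M] where
  coact : M →ₗ[k] M ⊗[k] C
  coassoc : (TensorProduct.assoc k M C C).toLinearMap ∘ₗ coact.rTensor C ∘ₗ coact =
    (Coalgebra.comul (R := k) (A := C)).lTensor M ∘ₗ coact
  counit : (TensorProduct.rid k M).toLinearMap ∘ₗ
    (Coalgebra.counit (R := k) (A := C)).lTensor M ∘ₗ coact = LinearMap.id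

/-- A left comodule `M` over the `k`-coalgebra `C`, with coaction `m ↦ m₍₋₁₎ ⊗ m₍₀₎`. -/
class LeftComodule (k C M : Type*) [Field k] [AddCommGroup C] [Module k C] [Coalgebra k C]
    [AddCommGroup M] [Module k M] where
  coact : M →ₗ[k] C ⊗[k] M
  coassoc : (TensorProduct.assoc k C C M).toLinearMap ∘ₗ
    (Coalgebra.comul (R := k) (A := C)).rTensor M ∘ₗ coact = coact.lTensor C ∘ₗ coact
  counit : (TensorProduct.lid k M).toLinearMap ∘ₗ
    (Coalgebra.counit (R := k) (A := C)).rTensor M ∘ₗ coact = LinearMap.id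

end Comodules

/-- `C` is an `H`-bimodule coalgebra, i.e. a coalgebra in the monoidal category of
`H`-bimodules: the comultiplication and the counit are morphisms of `H`-bimodules, where `H` acts
diagonally on `C ⊗ C` and through its counit on `k`. -/
class BimoduleCoalgebra (k H C : Type*) [Field k] [Ring H] [Bialgebra k H] [AddCommGroup C]
    [Module k C] [Coalgebra k C] [Module H C] [IsScalarTower k H C]
    [Module Hᵐᵒᵖ C] [IsScalarTower k Hᵐᵒᵖ C] : Prop extends SMulCommClass H Hᵐᵒᵖ C where
  comul_smul : ∀ (h : H) (c : C), Coalgebra.comul (R := k) (h • c) =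
    TensorProduct.map₂ (lact k H C) (lact k H C)
      (Coalgebra.comul (R := k) h) (Coalgebra.comul (R := k) c)
  counit_smul : ∀ (h : H) (c : C), Coalgebra.counit (R := k) (h • c) =
    Coalgebra.counit (R := k) h * Coalgebra.counit (R := k) c
  comul_op_smul : ∀ (h : H) (c : C), Coalgebra.comul (R := k) (MulOpposite.op h • c) =
    TensorProduct.map₂ (ract k H C) (ract k H C)
      (Coalgebra.comul (R := k) h) (Coalgebra.comul (R := k) c)
  counit_op_smul : ∀ (h : H) (c : C), Coalgebra.counit (R := k) (MulOpposite.op h • c) =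
    Coalgebra.counit (R := k) c * Coalgebra.counit (R := k) h

section Categories

variable (k H C : Type u) [Field k] [Ring H] [Bialgebra k H] [AddCommGroup C] [Module k C]
  [Coalgebra k C] [Module H C] [IsScalarTower k H C] [Module Hᵐᵒᵖ C] [IsScalarTower k Hᵐᵒᵖ C]

/-- For `m : M`, the linear map `H ⊗ H → M ⊗ C`,
`a ⊗ b ↦ (m b)₍₀₎ ⊗ a ▷ (m b)₍₁₎`. -/
def ydMap (M : Type*) [AddCommGroup M] [Module k M] [Module Hᵐᵒᵖ M] [IsScalarTower k Hᵐᵒᵖ M]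
    [RightComodule k C M] (m : M) : H ⊗[k] H →ₗ[k] M ⊗[k] C :=
  TensorProduct.lift
    (((LinearMap.lTensorHom M) ∘ₗ (lact k H C)).compl₂
      ((RightComodule.coact (k := k) (C := C)) ∘ₗ ((ract k H M).flip m)))

/-- A (right-right) Yetter–Drinfeld module over the bialgebra `H` and the `H`-bimodule
coalgebra `C`: a right `H`-module and right `C`-comodule `M` such that
`(m h₍₂₎)₍₀₎ ⊗ h₍₁₎ ▷ (m h₍₂₎)₍₁₎ = m₍₀₎ h₍₁₎ ⊗ m₍₁₎ ◁ h₍₂₎`. -/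
structure YDModule where
  carrier : Type u
  [addCommGroup : AddCommGroup carrier]
  [module : Module k carrier]
  [rightModule : Module Hᵐᵒᵖ carrier]
  [rightTower : IsScalarTower k Hᵐᵒᵖ carrier]
  [rightComodule : RightComodule k C carrier]
  yetterDrinfeld : ∀ (m : carrier) (h : H),
    ydMap k H C carrier m (Coalgebra.comul (R := k) h) =
      TensorProduct.map₂ (ract k H carrier) (ract k H C)
        (Coalgebra.comul (R := k) h) (RightComodule.coact (k := k) (C := C) m)

attribute [instance] YDModule.addCommGroup YDModule.module YDModule.rightModule
  YDModule.rightTower YDModule.rightComodule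

/-- An `H`-`C`-bicomodule in the monoidal category of `H`-bimodules: an `H`-bimodule `M` which is
an `H`-`C`-bicomodule such that both coactions `M → H ⊗ M` and `M → M ⊗ C` are `H`-bimodule maps
for the diagonal actions on the tensor products. -/
structure HopfBimodule where
  carrier : Type u
  [addCommGroup : AddCommGroup carrier]
  [module : Module k carrier]
  [leftModule : Module H carrier]
  [leftTower : IsScalarTower k H carrier]
  [rightModule : Module Hᵐᵒᵖ carrier]
  [rightTower : IsScalarTower k Hᵐᵒᵖ carrier]
  [smulComm : SMulCommClass H Hᵐᵒᵖ carrier]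
  [leftComodule : LeftComodule k H carrier]
  [rightComodule : RightComodule k C carrier]
  coact_comm : (TensorProduct.assoc k H carrier C).toLinearMap ∘ₗ
      (LeftComodule.coact (k := k) (C := H) (M := carrier)).rTensor C ∘ₗ
        RightComodule.coact (k := k) (C := C) =
    (RightComodule.coact (k := k) (C := C) (M := carrier)).lTensor H ∘ₗ
      LeftComodule.coact (k := k) (C := H)
  leftCoact_smul : ∀ (h : H) (m : carrier),
    LeftComodule.coact (k := k) (C := H) (h • m) =
      TensorProduct.map₂ (lact k H H) (lact k H carrier)
        (Coalgebra.comul (R := k) h) (LeftComodule.coact (k := k) (C := H) m)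
  leftCoact_op_smul : ∀ (h : H) (m : carrier),
    LeftComodule.coact (k := k) (C := H) (MulOpposite.op h • m) =
      TensorProduct.map₂ (ract k H H) (ract k H carrier)
        (Coalgebra.comul (R := k) h) (LeftComodule.coact (k := k) (C := H) m)
  rightCoact_smul : ∀ (h : H) (m : carrier),
    RightComodule.coact (k := k) (C := C) (h • m) =
      TensorProduct.map₂ (lact k H carrier) (lact k H C)
        (Coalgebra.comul (R := k) h) (RightComodule.coact (k := k) (C := C) m)
  rightCoact_op_smul : ∀ (h : H) (m : carrier),
    RightComodule.coact (k := k) (C := C) (MulOpposite.op h • m) =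
      TensorProduct.map₂ (ract k H carrier) (ract k H C)
        (Coalgebra.comul (R := k) h) (RightComodule.coact (k := k) (C := C) m)

attribute [instance] HopfBimodule.addCommGroup HopfBimodule.module HopfBimodule.leftModule
  HopfBimodule.leftTower HopfBimodule.rightModule HopfBimodule.rightTower HopfBimodule.smulComm
  HopfBimodule.leftComodule HopfBimodule.rightComodule

variable {k H C}

/-- The `k`-linear maps `M → N` that are right `H`-linear and right `C`-colinear. -/
def YDModule.homs (M N : YDModule k H C) : Submodule k (M.carrier →ₗ[k] N.carrier) where
  carrier := {f | (∀ (h : H) (m : M.carrier),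
      f (MulOpposite.op h • m) = MulOpposite.op h • f m) ∧
    ∀ m : M.carrier, RightComodule.coact (k := k) (C := C) (f m) =
      f.rTensor C (RightComodule.coact (k := k) (C := C) m)}
  add_mem' := by
    rintro f g ⟨hf, hf'⟩ ⟨hg, hg'⟩
    exact ⟨fun h m => by simp [hf, hg], fun m => by simp [hf', hg', LinearMap.rTensor_add]⟩
  zero_mem' := ⟨fun h m => by simp, fun m => by simp⟩
  smul_mem' := by
    rintro r f ⟨hf, hf'⟩
    exact ⟨fun h m => by simp [hf, smul_comm r (MulOpposite.op h)],
      fun m => by simp [hf', LinearMap.rTensor_smul]⟩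

/-- The `k`-linear maps `M → N` that are left and right `H`-linear, left `H`-colinear and
right `C`-colinear. -/
def HopfBimodule.homs (M N : HopfBimodule k H C) :
    Submodule k (M.carrier →ₗ[k] N.carrier) where
  carrier := {f | (∀ (h : H) (m : M.carrier), f (h • m) = h • f m) ∧
    (∀ (h : H) (m : M.carrier), f (MulOpposite.op h • m) = MulOpposite.op h • f m) ∧
    (∀ m : M.carrier, LeftComodule.coact (k := k) (C := H) (f m) =
      f.lTensor H (LeftComodule.coact (k := k) (C := H) m)) ∧
    ∀ m : M.carrier, RightComodule.coact (k := k) (C := C) (f m) =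
      f.rTensor C (RightComodule.coact (k := k) (C := C) m)}
  add_mem' := by
    rintro f g ⟨hf, hf', hf'', hf'''⟩ ⟨hg, hg', hg'', hg'''⟩
    exact ⟨fun h m => by simp [hf, hg], fun h m => by simp [hf', hg'],
      fun m => by simp [hf'', hg'', LinearMap.lTensor_add],
      fun m => by simp [hf''', hg''', LinearMap.rTensor_add]⟩
  zero_mem' := ⟨fun h m => by simp, fun h m => by simp, fun m => by simp, fun m => by simp⟩
  smul_mem' := by
    rintro r f ⟨hf, hf', hf'', hf'''⟩
    exact ⟨fun h m => by simp [hf, smul_comm r h],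
      fun h m => by simp [hf', smul_comm r (MulOpposite.op h)],
      fun m => by simp [hf'', LinearMap.lTensor_smul],
      fun m => by simp [hf''', LinearMap.rTensor_smul]⟩

instance : Category (YDModule k H C) where
  Hom M N := YDModule.homs M N
  id M := ⟨LinearMap.id, fun _ _ => rfl, fun _ => by simp⟩
  comp f g := ⟨g.1 ∘ₗ f.1,
    fun h m => by simp [f.2.1, g.2.1],
    fun m => by simp [f.2.2, g.2.2, LinearMap.rTensor_comp]⟩

instance : Category (HopfBimodule k H C) where
  Hom M N := HopfBimodule.homs M N
  id M := ⟨LinearMap.id, fun _ _ => rfl, fun _ _ => rfl, fun _ => by simp, fun _ => by simp⟩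
  comp f g := ⟨g.1 ∘ₗ f.1,
    fun h m => by simp [f.2.1, g.2.1],
    fun h m => by simp [f.2.2.1, g.2.2.1],
    fun m => by simp [f.2.2.2.1, g.2.2.2.1, LinearMap.lTensor_comp],
    fun m => by simp [f.2.2.2.2, g.2.2.2.2, LinearMap.rTensor_comp]⟩

/-- Morphisms are added as linear maps. -/
instance : Preadditive (YDModule k H C) where
  homGroup M N := inferInstanceAs (AddCommGroup (YDModule.homs M N))
  add_comp _ _ _ f f' g := Subtype.ext (LinearMap.comp_add f.1 f'.1 g.1)
  comp_add _ _ _ f g g' := Subtype.ext (LinearMap.add_comp f.1 g'.1 g.1)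

/-- Morphisms are added as linear maps. -/
instance : Preadditive (HopfBimodule k H C) where
  homGroup M N := inferInstanceAs (AddCommGroup (HopfBimodule.homs M N))
  add_comp _ _ _ f f' g := Subtype.ext (LinearMap.comp_add f.1 f'.1 g.1)
  comp_add _ _ _ f g g' := Subtype.ext (LinearMap.add_comp f.1 g'.1 g.1)

instance : Linear k (YDModule k H C) where
  homModule M N := inferInstanceAs (Module k (YDModule.homs M N))
  smul_comp _ _ _ r f g := Subtype.ext (LinearMap.comp_smul g.1 r f.1)
  comp_smul _ _ _ f r g := Subtype.ext (LinearMap.smul_comp r g.1 f.1)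

instance : Linear k (HopfBimodule k H C) where
  homModule M N := inferInstanceAs (Module k (HopfBimodule.homs M N))
  smul_comp _ _ _ r f g := Subtype.ext (LinearMap.comp_smul g.1 r f.1)
  comp_smul _ _ _ f r g := Subtype.ext (LinearMap.smul_comp r g.1 f.1)

end Categories

end HopfYD

/-! The equivalence is M ↦ H ⊗ M. The left action is multiplication on H, the right action is
diagonal, the left coaction is Δ on H, and C coacts by g ⊗ m ↦ (g₍₁₎ ⊗ m₍₀₎) ⊗ g₍₂₎ ▷ m₍₁₎. The
Yetter–Drinfeld condition is what makes this last coaction right H-linear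
(`induced_rightCoact_op_smul`).

Full faithfulness holds over any bialgebra. A left colinear φ sends the coinvariant 1 ⊗ m to a
coinvariant, necessarily of the form 1 ⊗ f(m), and left linearity then gives φ = id ⊗ f
(`exists_eq_lTensor`).

Essential surjectivity is the fundamental theorem of Hopf modules. Put p(m) = S(m₍₋₁₎) m₍₀₎. It
projects M onto the left coinvariants V (`leftCoact_proj`), and m = m₍₋₁₎ p(m₍₀₎), so h ⊗ v ↦ h v is
an isomorphism H ⊗ V → M (`coinvariantsEquiv`). The right action on V is v ↦ p(v h) and the
C-coaction of M restricts to V; the compatibility of the two is read off from the right linearity of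
the coaction on M (`coinvariants_yetterDrinfeld`). The arguments rest on S(h₍₁₎) h₍₂₎ = ε(h) = h₍₁₎
S(h₍₂₎); neither bijectivity nor antimultiplicativity of S enters. -/

namespace HopfYD

open TensorProduct Coalgebra HopfAlgebra

/-! ### The Hopf bimodule structure on H ⊗ M -/

section Induced

set_option linter.unusedSectionVars false

variable (k H C M : Type u) [Field k] [Ring H] [Bialgebra k H]
  [AddCommGroup C] [Module k C] [Coalgebra k C] [Module H C] [IsScalarTower k H C]
  [Module Hᵐᵒᵖ C] [IsScalarTower k Hᵐᵒᵖ C]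
  [AddCommGroup M] [Module k M] [Module Hᵐᵒᵖ M] [IsScalarTower k Hᵐᵒᵖ M] [RightComodule k C M]

/-- The diagonal right action of `H` on `H ⊗ M`. -/
local instance (priority := 2000) diagonalSMul : SMul Hᵐᵒᵖ (H ⊗[k] M) where
  smul h x := TensorProduct.map₂ (ract k H H) (ract k H M) (comul (R := k) h.unop) x

/-- `H ⊗ M` is a right `H`-module for the diagonal action. -/
local instance (priority := 2000) diagonalRightModule : Module Hᵐᵒᵖ (H ⊗[k] M) where
  one_smul x := by
    change TensorProduct.map₂ (ract k H H) (ract k H M) (comul (R := k) (1 : H)) x = x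
    rw [Bialgebra.comul_one, Algebra.TensorProduct.one_def]
    induction x with
    | zero => simp
    | add x y hx hy => rw [map_add, hx, hy]
    | tmul g m => simp
  mul_smul a b x := by
    change TensorProduct.map₂ (ract k H H) (ract k H M) (comul (R := k) (b.unop * a.unop)) x =
      TensorProduct.map₂ (ract k H H) (ract k H M) (comul (R := k) a.unop)
        (TensorProduct.map₂ (ract k H H) (ract k H M) (comul (R := k) b.unop) x)
    rw [Bialgebra.comul_mul]
    generalize comul (R := k) b.unop = s
    generalize comul (R := k) a.unop = t
    induction x with
    | zero => simp
    | add x y hx hy => simp only [map_add, hx, hy]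
    | tmul g m =>
      induction t with
      | zero => simp
      | add x y hx hy => simp only [map_add, LinearMap.add_apply, mul_add, hx, hy]
      | tmul a a' =>
        induction s with
        | zero => simp
        | add x y hx hy => simp only [map_add, LinearMap.add_apply, add_mul, hx, hy]
        | tmul b b' => simp [mul_smul, mul_assoc]
  smul_zero _ := map_zero _
  smul_add _ _ _ := map_add _ _ _
  add_smul a b x := by
    change TensorProduct.map₂ _ _ (comul (R := k) (a.unop + b.unop)) x = _
    rw [map_add, map_add]; rfl
  zero_smul x := by
    change TensorProduct.map₂ _ _ (comul (R := k) (0 : H)) x = _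
    rw [map_zero, map_zero]; rfl

theorem diagonal_op_smul (h : H) (x : H ⊗[k] M) : MulOpposite.op h • x =
    TensorProduct.map₂ (ract k H H) (ract k H M) (comul (R := k) h) x := rfl

-- The raised priority makes the diagonal action win over the standard instance, for which `Hᵐᵒᵖ`
-- acts on the left tensor factor only. The left H-action, by contrast, is the standard one.
local instance (priority := 2000) diagonalRightModule_isScalarTower : IsScalarTower k Hᵐᵒᵖ (H ⊗[k] M) where
  smul_assoc r h x := by
    change TensorProduct.map₂ _ _ (comul (R := k) (r • h.unop)) x = _
    rw [map_smul, map_smul]; rfl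

local instance (priority := 2000) diagonalRightModule_smulCommClass : SMulCommClass H Hᵐᵒᵖ (H ⊗[k] M) where
  smul_comm a h x := by
    obtain ⟨h, rfl⟩ := MulOpposite.op_surjective h
    simp only [diagonal_op_smul]
    generalize comul (R := k) h = t
    induction x with
    | zero => simp
    | add x y hx hy => simp only [map_add, smul_add, hx, hy]
    | tmul g m =>
      induction t with
      | zero => simp
      | add x y hx hy => simp only [map_add, LinearMap.add_apply, smul_add, hx, hy]
      | tmul b b' => simp [TensorProduct.smul_tmul', mul_assoc]

/-- The left coaction `g ⊗ m ↦ g₍₁₎ ⊗ (g₍₂₎ ⊗ m)` of `H` on `H ⊗ M`. -/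
local instance inducedLeftComodule : LeftComodule k H (H ⊗[k] M) where
  coact := (TensorProduct.assoc k H H M).toLinearMap ∘ₗ (comul (R := k) (A := H)).rTensor M
  coassoc := by
    ext g m
    -- An arbitrary tensor t replaces Δ(g), so that induction on pure tensors applies;
    -- coassociativity enters only after specialising back. This device recurs throughout.
    have key : ∀ t : H ⊗[k] H, TensorProduct.assoc k H H (H ⊗[k] M)
          ((comul (R := k)).rTensor (H ⊗[k] M) (TensorProduct.assoc k H H M (t ⊗ₜ m))) =
        ((TensorProduct.assoc k H H M).toLinearMap.lTensor H ∘ₗ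
          (TensorProduct.assoc k H (H ⊗[k] H) M).toLinearMap)
          (TensorProduct.assoc k H H H ((comul (R := k)).rTensor H t) ⊗ₜ m) := by
      intro t
      induction t with
      | zero => simp
      | add x y hx hy => simp only [map_add, add_tmul, hx, hy]
      | tmul a b =>
        simp only [assoc_tmul, LinearMap.rTensor_tmul]
        generalize comul (R := k) a = s
        induction s with
        | zero => simp
        | add x y hx hy => simp only [map_add, add_tmul, hx, hy]
        | tmul a a' => simp
    have key' : ∀ t : H ⊗[k] H,
        ((TensorProduct.assoc k H H M).toLinearMap ∘ₗ
          (comul (R := k) (A := H)).rTensor M).lTensor H (TensorProduct.assoc k H H M (t ⊗ₜ m)) =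
        ((TensorProduct.assoc k H H M).toLinearMap.lTensor H ∘ₗ
          (TensorProduct.assoc k H (H ⊗[k] H) M).toLinearMap)
          ((comul (R := k)).lTensor H t ⊗ₜ m) := by
      intro t
      induction t with
      | zero => simp
      | add x y hx hy => simp only [map_add, add_tmul, hx, hy]
      | tmul a b => simp
    have h1 := key (comul g)
    rw [coassoc_apply, ← key'] at h1
    simpa using h1
  counit := by
    ext g m
    have key : ∀ t : H ⊗[k] H, TensorProduct.lid k (H ⊗[k] M)
          ((counit (R := k)).rTensor (H ⊗[k] M) (TensorProduct.assoc k H H M (t ⊗ₜ m))) =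
        TensorProduct.lid k H ((counit (R := k)).rTensor H t) ⊗ₜ m := by
      intro t
      induction t with
      | zero => simp
      | add x y hx hy => simp only [map_add, add_tmul, hx, hy]
      | tmul a b => simp [smul_tmul']
    simpa using key (comul g)

theorem induced_leftCoact_tmul (g : H) (m : M) :
    LeftComodule.coact (k := k) (C := H) (g ⊗ₜ[k] m) =
      TensorProduct.assoc k H H M (comul (R := k) g ⊗ₜ m) := rfl

/-- The right coaction `g ⊗ m ↦ (g₍₁₎ ⊗ m₍₀₎) ⊗ g₍₂₎ ▷ m₍₁₎` of `C` on `H ⊗ M`. -/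
def inducedRightCoact : H ⊗[k] M →ₗ[k] (H ⊗[k] M) ⊗[k] C :=
  TensorProduct.lift ((TensorProduct.map₂ (TensorProduct.mk k H M) (lact k H C)).compl₁₂
    (comul (R := k) (A := H)) (RightComodule.coact (k := k) (C := C)))

@[simp]
theorem inducedRightCoact_tmul (g : H) (m : M) : inducedRightCoact k H C M (g ⊗ₜ m) =
    TensorProduct.map₂ (TensorProduct.mk k H M) (lact k H C) (comul (R := k) g)
      (RightComodule.coact (k := k) (C := C) m) := rfl

/-- `H ⊗ M` is a right `C`-comodule. -/
local instance inducedRightComodule [BimoduleCoalgebra k H C] : RightComodule k C (H ⊗[k] M) where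
  coact := inducedRightCoact k H C M
  coassoc := by
    ext g m
    -- Ψ pairs a ⊗ b ⊗ b' with m ⊗ c ⊗ c' to give (a ⊗ m) ⊗ (b ▷ c ⊗ b' ▷ c'). Both sides of the
    -- axiom are values of Ψ, and they agree by coassociativity of H and of M.
    let Ψ := TensorProduct.map₂ (TensorProduct.mk k H M)
      (TensorProduct.map₂ (lact k H C) (lact k H C))
    have key : ∀ (t : H ⊗[k] H) (s : M ⊗[k] C),
        TensorProduct.assoc k (H ⊗[k] M) C C ((inducedRightCoact k H C M).rTensor C
          (TensorProduct.map₂ (TensorProduct.mk k H M) (lact k H C) t s)) =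
        Ψ (TensorProduct.assoc k H H H ((comul (R := k)).rTensor H t))
          (TensorProduct.assoc k M C C
            ((RightComodule.coact (k := k) (C := C)).rTensor C s)) := by
      intro t s
      induction t with
      | zero => simp
      | add x y hx hy => simp only [map_add, LinearMap.add_apply, hx, hy]
      | tmul a b =>
        induction s with
        | zero => simp
        | add x y hx hy => simp only [map_add, hx, hy]
        | tmul m c =>
          simp only [map₂_apply_tmul, map_tmul, mk_apply, LinearMap.rTensor_tmul,
            inducedRightCoact_tmul]
          generalize comul (R := k) a = t
          generalize RightComodule.coact (k := k) (C := C) m = s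
          induction t with
          | zero => simp
          | add x y hx hy => simp only [map_add, LinearMap.add_apply, add_tmul, hx, hy]
          | tmul a a' =>
            induction s with
            | zero => simp
            | add x y hx hy => simp only [map_add, add_tmul, hx, hy]
            | tmul m c => simp [Ψ]
    have key' : ∀ (t : H ⊗[k] H) (s : M ⊗[k] C),
        (comul (R := k)).lTensor (H ⊗[k] M)
          (TensorProduct.map₂ (TensorProduct.mk k H M) (lact k H C) t s) =
        Ψ ((comul (R := k)).lTensor H t) ((comul (R := k)).lTensor M s) := by
      intro t s
      induction t with
      | zero => simp
      | add x y hx hy => simp only [map_add, LinearMap.add_apply, hx, hy]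
      | tmul a b =>
        induction s with
        | zero => simp
        | add x y hx hy => simp only [map_add, hx, hy]
        | tmul m c => simp [Ψ, BimoduleCoalgebra.comul_smul]
    have hM := LinearMap.congr_fun (RightComodule.coassoc (k := k) (C := C) (M := M)) m
    have h1 := key (comul g) (RightComodule.coact m)
    simp only [LinearMap.comp_apply, LinearEquiv.coe_coe] at hM
    rw [coassoc_apply, hM, ← key'] at h1
    simpa using h1
  counit := by
    ext g m
    have key : ∀ (t : H ⊗[k] H) (s : M ⊗[k] C),
        TensorProduct.rid k (H ⊗[k] M) ((counit (R := k)).lTensor (H ⊗[k] M)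
          (TensorProduct.map₂ (TensorProduct.mk k H M) (lact k H C) t s)) =
        TensorProduct.rid k H ((counit (R := k)).lTensor H t) ⊗ₜ
          TensorProduct.rid k M ((counit (R := k)).lTensor M s) := by
      intro t s
      induction t with
      | zero => simp
      | add x y hx hy => simp only [map_add, LinearMap.add_apply, add_tmul, hx, hy]
      | tmul a b =>
        induction s with
        | zero => simp
        | add x y hx hy => simp only [map_add, tmul_add, hx, hy]
        | tmul m c => 
          simp only [map₂_apply_tmul, map_tmul, mk_apply, lact_apply, LinearMap.lTensor_tmul,
            BimoduleCoalgebra.counit_smul, rid_tmul, mul_smul, smul_tmul', tmul_smul]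
          rw [smul_comm (counit (R := k) b)]
    have hM := LinearMap.congr_fun (RightComodule.counit (k := k) (C := C) (M := M)) m
    have h1 := key (comul g) (RightComodule.coact m)
    simp only [LinearMap.comp_apply, LinearEquiv.coe_coe, LinearMap.id_apply] at hM
    rw [hM] at h1
    simpa using h1

theorem induced_rightCoact_tmul [BimoduleCoalgebra k H C] (g : H) (m : M) :
    RightComodule.coact (k := k) (C := C) (g ⊗ₜ[k] m) =
      TensorProduct.map₂ (TensorProduct.mk k H M) (lact k H C) (comul (R := k) g)
        (RightComodule.coact (k := k) (C := C) m) := rfl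

/-- Both composites send g ⊗ m to g₍₁₎ ⊗ ((g₍₂₎ ⊗ m₍₀₎) ⊗ g₍₃₎ ▷ m₍₁₎), so coassociativity of H
suffices. -/
theorem induced_coact_comm [BimoduleCoalgebra k H C] :
    (TensorProduct.assoc k H (H ⊗[k] M) C).toLinearMap ∘ₗ
      (LeftComodule.coact (k := k) (C := H) (M := H ⊗[k] M)).rTensor C ∘ₗ
        RightComodule.coact (k := k) (C := C) =
    (RightComodule.coact (k := k) (C := C) (M := H ⊗[k] M)).lTensor H ∘ₗ
      LeftComodule.coact (k := k) (C := H) := by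
  ext g m
  let Ψ : H ⊗[k] (H ⊗[k] H) →ₗ[k] M ⊗[k] C →ₗ[k] H ⊗[k] ((H ⊗[k] M) ⊗[k] C) :=
    TensorProduct.lift (((LinearMap.llcomp k (M ⊗[k] C) ((H ⊗[k] M) ⊗[k] C)
      (H ⊗[k] ((H ⊗[k] M) ⊗[k] C))).compl₁₂ (TensorProduct.mk k H ((H ⊗[k] M) ⊗[k] C))
      (TensorProduct.map₂ (TensorProduct.mk k H M) (lact k H C))))
  have key : ∀ (t : H ⊗[k] H) (s : M ⊗[k] C),
      TensorProduct.assoc k H (H ⊗[k] M) C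
        ((LeftComodule.coact (k := k) (C := H) (M := H ⊗[k] M)).rTensor C
          (TensorProduct.map₂ (TensorProduct.mk k H M) (lact k H C) t s)) =
      Ψ (TensorProduct.assoc k H H H ((comul (R := k)).rTensor H t)) s := by
    intro t s
    induction t with
    | zero => simp
    | add x y hx hy => simp only [map_add, LinearMap.add_apply, hx, hy]
    | tmul a b =>
      induction s with
      | zero => simp
      | add x y hx hy => simp only [map_add, hx, hy]
      | tmul m c =>
        simp only [map₂_apply_tmul, map_tmul, mk_apply, LinearMap.rTensor_tmul,
          induced_leftCoact_tmul]
        generalize comul (R := k) a = t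
        induction t with
        | zero => simp
        | add x y hx hy => simp only [map_add, LinearMap.add_apply, add_tmul, hx, hy]
        | tmul a a' => simp [Ψ]
  have key' : ∀ t : H ⊗[k] H, (RightComodule.coact (k := k) (C := C) (M := H ⊗[k] M)).lTensor H
        (TensorProduct.assoc k H H M (t ⊗ₜ m)) =
      Ψ ((comul (R := k)).lTensor H t) (RightComodule.coact (k := k) (C := C) m) := by
    intro t
    induction t with
    | zero => simp
    | add x y hx hy => simp only [map_add, add_tmul, LinearMap.add_apply, hx, hy]
    | tmul a b => simp [Ψ, induced_rightCoact_tmul]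
  have h1 := key (comul g) (RightComodule.coact m)
  rw [coassoc_apply, ← key'] at h1
  simpa [induced_leftCoact_tmul, induced_rightCoact_tmul] using h1

theorem induced_leftCoact_smul (h : H) (x : H ⊗[k] M) :
    LeftComodule.coact (k := k) (C := H) (h • x) =
      TensorProduct.map₂ (lact k H H) (lact k H (H ⊗[k] M))
        (comul (R := k) h) (LeftComodule.coact (k := k) (C := H) x) := by
  induction x with
  | zero => simp
  | add x y hx hy => simp only [smul_add, map_add, hx, hy]
  | tmul g m =>
    rw [smul_tmul', smul_eq_mul, induced_leftCoact_tmul, induced_leftCoact_tmul,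
      Bialgebra.comul_mul]
    generalize comul (R := k) h = s
    generalize comul (R := k) g = t
    induction s with
    | zero => simp
    | add x y hx hy => simp only [map_add, LinearMap.add_apply, add_tmul, add_mul, hx, hy]
    | tmul a b =>
      induction t with
      | zero => simp
      | add x y hx hy => simp only [map_add, add_tmul, mul_add, hx, hy]
      | tmul c d => simp [smul_tmul']

/-- On g ⊗ m both sides are g₍₁₎h₍₁₎ ⊗ (g₍₂₎h₍₂₎ ⊗ m h₍₃₎), by multiplicativity of Δ and
coassociativity. -/
theorem induced_leftCoact_op_smul (h : H) (x : H ⊗[k] M) :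
    LeftComodule.coact (k := k) (C := H) (MulOpposite.op h • x) =
      TensorProduct.map₂ (ract k H H) (ract k H (H ⊗[k] M))
        (comul (R := k) h) (LeftComodule.coact (k := k) (C := H) x) := by
  rw [diagonal_op_smul]
  induction x with
  | zero => simp
  | add x y hx hy => simp only [map_add, hx, hy]
  | tmul g m =>
    rw [induced_leftCoact_tmul]
    have key : ∀ t : H ⊗[k] H, LeftComodule.coact (k := k) (C := H)
          (TensorProduct.map₂ (ract k H H) (ract k H M) t (g ⊗ₜ m)) =
        TensorProduct.map₂ (ract k H H) (TensorProduct.map₂ (ract k H H) (ract k H M))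
          (TensorProduct.assoc k H H H ((comul (R := k)).rTensor H t))
          (TensorProduct.assoc k H H M (comul (R := k) g ⊗ₜ m)) := by
      intro t
      induction t with
      | zero => simp
      | add x y hx hy => simp only [map_add, LinearMap.add_apply, hx, hy]
      | tmul a b =>
        simp only [map₂_apply_tmul, map_tmul, induced_leftCoact_tmul, ract_apply,
          LinearMap.rTensor_tmul, op_smul_eq_mul, Bialgebra.comul_mul]
        generalize comul (R := k) g = s
        generalize comul (R := k) a = t
        induction t with
        | zero => simp
        | add x y hx hy => simp only [map_add, LinearMap.add_apply, add_tmul, mul_add, hx, hy]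
        | tmul a a' =>
          induction s with
          | zero => simp
          | add x y hx hy => simp only [map_add, add_tmul, add_mul, hx, hy]
          | tmul c d => simp
    have key' : ∀ t s : H ⊗[k] H,
        TensorProduct.map₂ (ract k H H) (ract k H (H ⊗[k] M)) t
          (TensorProduct.assoc k H H M (s ⊗ₜ m)) =
        TensorProduct.map₂ (ract k H H) (TensorProduct.map₂ (ract k H H) (ract k H M))
          ((comul (R := k)).lTensor H t) (TensorProduct.assoc k H H M (s ⊗ₜ m)) := by
      intro t s
      induction t with
      | zero => simp
      | add x y hx hy => simp only [map_add, LinearMap.add_apply, hx, hy]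
      | tmul a b =>
        induction s with
        | zero => simp
        | add x y hx hy => simp only [map_add, add_tmul, hx, hy]
        | tmul c d => simp [diagonal_op_smul]
    rw [key, key', coassoc_apply]

theorem induced_rightCoact_smul [BimoduleCoalgebra k H C] (h : H) (x : H ⊗[k] M) :
    RightComodule.coact (k := k) (C := C) (h • x) =
      TensorProduct.map₂ (lact k H (H ⊗[k] M)) (lact k H C)
        (comul (R := k) h) (RightComodule.coact (k := k) (C := C) x) := by
  induction x with
  | zero => simp
  | add x y hx hy => simp only [smul_add, map_add, hx, hy]
  | tmul g m =>
    rw [smul_tmul', smul_eq_mul, induced_rightCoact_tmul, induced_rightCoact_tmul,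
      Bialgebra.comul_mul]
    generalize comul (R := k) h = s
    generalize comul (R := k) g = t
    generalize RightComodule.coact (k := k) (C := C) m = u
    induction s with
    | zero => simp
    | add x y hx hy => simp only [map_add, LinearMap.add_apply, add_mul, hx, hy]
    | tmul a b =>
      induction t with
      | zero => simp
      | add x y hx hy => simp only [map_add, LinearMap.add_apply, mul_add, hx, hy]
      | tmul c d =>
        induction u with
        | zero => simp
        | add x y hx hy => simp only [map_add, hx, hy]
        | tmul m e => simp [smul_tmul', mul_smul]

/-- On g ⊗ m the left side is g₍₁₎h₍₁₎ ⊗ (m h₍₃₎)₍₀₎ ⊗ g₍₂₎h₍₂₎ ▷ (m h₍₃₎)₍₁₎ and the right side is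
g₍₁₎h₍₁₎ ⊗ m₍₀₎h₍₂₎ ⊗ (g₍₂₎ ▷ m₍₁₎) ◁ h₍₃₎. They match by `yd` applied to the second leg of Δ(h),
since the two actions on C commute. -/
theorem induced_rightCoact_op_smul [BimoduleCoalgebra k H C]
    (yd : ∀ (m : M) (h : H), ydMap k H C M m (comul (R := k) h) =
      TensorProduct.map₂ (ract k H M) (ract k H C)
        (comul (R := k) h) (RightComodule.coact (k := k) (C := C) m))
    (h : H) (x : H ⊗[k] M) :
    RightComodule.coact (k := k) (C := C) (MulOpposite.op h • x) =
      TensorProduct.map₂ (ract k H (H ⊗[k] M)) (ract k H C)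
        (comul (R := k) h) (RightComodule.coact (k := k) (C := C) x) := by
  rw [diagonal_op_smul]
  induction x with
  | zero => simp
  | add x y hx hy => simp only [map_add, hx, hy]
  | tmul g m =>
    rw [induced_rightCoact_tmul]
    -- Ω splits off the left action of Δ(g), leaving on each side a map of h₍₁₎ ⊗ h₍₂₎ ⊗ h₍₃₎. It is
    -- a bare function of t, whence the two additivity facts below.
    let Ω : H ⊗[k] H → H ⊗[k] (M ⊗[k] C) →ₗ[k] (H ⊗[k] M) ⊗[k] C := fun t =>
      TensorProduct.map₂ (lact k H (H ⊗[k] M)) (lact k H C) t ∘ₗ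
        (TensorProduct.assoc k H M C).symm.toLinearMap
    have hΩ : ∀ t t' z, Ω (t + t') z = Ω t z + Ω t' z := fun t t' z => by simp [Ω]
    have hΩ0 : ∀ z, Ω 0 z = 0 := fun z => by simp [Ω]
    have key : ∀ t : H ⊗[k] H, RightComodule.coact (k := k) (C := C)
          (TensorProduct.map₂ (ract k H H) (ract k H M) t (g ⊗ₜ m)) =
        Ω (comul g) ((ydMap k H C M m).lTensor H
          (TensorProduct.assoc k H H H ((comul (R := k)).rTensor H t))) := by
      intro t
      induction t with
      | zero => simp
      | add x y hx hy => simp only [map_add, LinearMap.add_apply, hx, hy]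
      | tmul a b =>
        simp only [map₂_apply_tmul, map_tmul, induced_rightCoact_tmul, ract_apply,
          LinearMap.rTensor_tmul, op_smul_eq_mul, Bialgebra.comul_mul]
        generalize comul (R := k) g = s
        generalize comul (R := k) a = t
        induction t with
        | zero => simp
        | add x y hx hy => simp only [map_add, LinearMap.add_apply, add_tmul, mul_add, hx, hy]
        | tmul a a' =>
          induction s with
          | zero => simp [hΩ0]
          | add x y hx hy => simp only [map_add, LinearMap.add_apply, add_mul, hΩ, hx, hy]
          | tmul c d =>
            simp only [Algebra.TensorProduct.tmul_mul_tmul, assoc_tmul, LinearMap.lTensor_tmul,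
              ydMap, lift.tmul, LinearMap.compl₂_apply, LinearMap.comp_apply,
              LinearMap.flip_apply, ract_apply]
            generalize RightComodule.coact (k := k) (C := C) (MulOpposite.op b • m) = u
            induction u with
            | zero => simp
            | add x y hx hy => simp only [map_add, tmul_add, hx, hy]
            | tmul n e => simp [Ω, smul_tmul', mul_smul]
    have key' : ∀ (t s : H ⊗[k] H) (u : M ⊗[k] C),
        TensorProduct.map₂ (ract k H (H ⊗[k] M)) (ract k H C) t
          (TensorProduct.map₂ (TensorProduct.mk k H M) (lact k H C) s u) =
        Ω s (((TensorProduct.map₂ (ract k H M) (ract k H C)).flip u).lTensor H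
          (TensorProduct.assoc k H H H ((comul (R := k)).rTensor H t))) := by
      intro t s u
      induction t with
      | zero => simp
      | add x y hx hy => simp only [map_add, LinearMap.add_apply, hx, hy]
      | tmul a b =>
        induction s with
        | zero => simp [hΩ0]
        | add x y hx hy => simp only [map_add, LinearMap.add_apply, hΩ, hx, hy]
        | tmul c d =>
          induction u with
          | zero => simp
          | add x y hx hy =>
            simp only [map_add, LinearMap.lTensor_add, LinearMap.add_apply, hx, hy]
          | tmul n e =>
            simp only [map₂_apply_tmul, map_tmul, mk_apply, ract_apply, lact_apply,
              diagonal_op_smul, LinearMap.rTensor_tmul]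
            generalize comul (R := k) a = t
            induction t with
            | zero => simp
            | add x y hx hy => simp only [map_add, LinearMap.add_apply, add_tmul, hx, hy]
            | tmul a a' => simp [Ω, smul_tmul', smul_comm d]
    -- As an identity of linear maps in h, the condition can be tensored with the first leg.
    have hyd : ydMap k H C M m ∘ₗ comul (R := k) (A := H) =
        (TensorProduct.map₂ (ract k H M) (ract k H C)).flip
          (RightComodule.coact (k := k) (C := C) m) ∘ₗ comul (R := k) (A := H) :=
      LinearMap.ext (yd m)
    rw [key, key', coassoc_apply, ← LinearMap.lTensor_comp_apply, ← LinearMap.lTensor_comp_apply,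
      hyd]

/-! ### Recovering M from H ⊗ M by the counit -/

/-- The map `g ⊗ m ↦ ε(g) m`. -/
def counitMap : H ⊗[k] M →ₗ[k] M :=
  (TensorProduct.lid k M).toLinearMap ∘ₗ (counit (R := k) (A := H)).rTensor M

@[simp]
theorem counitMap_tmul (g : H) (m : M) : counitMap k H M (g ⊗ₜ m) = counit (R := k) g • m := rfl

/-- ε(g h₍₁₎) m h₍₂₎ = ε(g) m h, by multiplicativity of ε and the counit law. -/
theorem counitMap_op_smul (h : H) (x : H ⊗[k] M) :
    counitMap k H M (MulOpposite.op h • x) = MulOpposite.op h • counitMap k H M x := by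
  rw [diagonal_op_smul]
  induction x with
  | zero => simp
  | add x y hx hy => simp only [map_add, smul_add, hx, hy]
  | tmul g m =>
    have key : ∀ t : H ⊗[k] H,
        counitMap k H M (TensorProduct.map₂ (ract k H H) (ract k H M) t (g ⊗ₜ m)) =
        counit (R := k) g • ract k H M (TensorProduct.lid k H (counit.rTensor H t)) m := by
      intro t
      induction t with
      | zero => simp
      | add x y hx hy => simp only [map_add, LinearMap.add_apply, smul_add, hx, hy]
      | tmul a b => simp [mul_smul]
    rw [key, rTensor_counit_comul]
    simp [smul_comm (counit (R := k) g)]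

/-- This is cofreeness of H ⊗ M as a left comodule: a colinear map into it is determined by its
composite with ε ⊗ id. -/
theorem lTensor_counitMap_leftCoact (x : H ⊗[k] M) :
    (counitMap k H M).lTensor H (LeftComodule.coact (k := k) (C := H) x) = x := by
  induction x with
  | zero => simp
  | add x y hx hy => simp only [map_add, hx, hy]
  | tmul g m =>
    rw [induced_leftCoact_tmul]
    have key : ∀ t : H ⊗[k] H,
        (counitMap k H M).lTensor H (TensorProduct.assoc k H H M (t ⊗ₜ m)) =
        TensorProduct.rid k H (counit.lTensor H t) ⊗ₜ m := by
      intro t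
      induction t with
      | zero => simp
      | add x y hx hy => simp only [map_add, add_tmul, hx, hy]
      | tmul a b => simp [smul_tmul]
    simp [key]

/-- The element 1 matters: for general g the result is m₍₀₎ ⊗ g ▷ m₍₁₎, so ε ⊗ id need not be
C-colinear. -/
theorem rTensor_counitMap_rightCoact_one_tmul [BimoduleCoalgebra k H C] (m : M) :
    (counitMap k H M).rTensor C (RightComodule.coact (k := k) (C := C) ((1 : H) ⊗ₜ[k] m)) =
      RightComodule.coact (k := k) (C := C) m := by
  rw [induced_rightCoact_tmul, Bialgebra.comul_one, Algebra.TensorProduct.one_def]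
  generalize RightComodule.coact (k := k) (C := C) m = u
  induction u with
  | zero => simp
  | add x y hx hy => simp only [map_add, hx, hy]
  | tmul n c => simp

/-! ### The functor M ↦ H ⊗ M is fully faithful -/

section Functor

variable {k H C}
variable [BimoduleCoalgebra k H C]

/-- The Hopf bimodule `H ⊗ M` induced by a Yetter–Drinfeld module `M`. -/
def induced (M : YDModule k H C) : HopfBimodule k H C where
  carrier := H ⊗[k] M.carrier
  coact_comm := induced_coact_comm k H C M.carrier
  leftCoact_smul := induced_leftCoact_smul k H M.carrier
  leftCoact_op_smul := induced_leftCoact_op_smul k H M.carrier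
  rightCoact_smul := induced_rightCoact_smul k H C M.carrier
  rightCoact_op_smul := induced_rightCoact_op_smul k H C M.carrier M.yetterDrinfeld

theorem lTensor_mem_homs {M N : YDModule k H C} {f : M.carrier →ₗ[k] N.carrier}
    (hf : f ∈ YDModule.homs M N) : f.lTensor H ∈ HopfBimodule.homs (induced M) (induced N) := by
  refine ⟨fun h x => ?_, fun h x => ?_, fun x => ?_, fun x => ?_⟩
  · change f.lTensor H (h • (show H ⊗[k] M.carrier from x)) = h • f.lTensor H x
    induction (show H ⊗[k] M.carrier from x) with
    | zero => simp
    | add x y hx hy => simp only [smul_add, map_add, hx, hy]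
    | tmul g m => simp [smul_tmul']
  · change f.lTensor H (TensorProduct.map₂ (ract k H H) (ract k H M.carrier) (comul h) x) =
      TensorProduct.map₂ (ract k H H) (ract k H N.carrier) (comul h) (f.lTensor H x)
    induction (show H ⊗[k] M.carrier from x) with
    | zero => simp
    | add x y hx hy => simp only [map_add, hx, hy]
    | tmul g m =>
      generalize comul (R := k) h = t
      induction t with
      | zero => simp
      | add x y hx hy => simp only [map_add, LinearMap.add_apply, hx, hy]
      | tmul a b => simp [hf.1]
  · change LeftComodule.coact (k := k) (C := H) (M := H ⊗[k] N.carrier) (f.lTensor H x) =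
      (f.lTensor H).lTensor H
        (LeftComodule.coact (k := k) (C := H) (M := H ⊗[k] M.carrier) x)
    induction (show H ⊗[k] M.carrier from x) with
    | zero => simp
    | add x y hx hy => simp only [map_add, hx, hy]
    | tmul g m =>
      rw [LinearMap.lTensor_tmul, induced_leftCoact_tmul, induced_leftCoact_tmul]
      generalize comul (R := k) g = t
      induction t with
      | zero => simp
      | add x y hx hy => simp only [map_add, add_tmul, hx, hy]
      | tmul a b => simp
  · change RightComodule.coact (k := k) (C := C) (M := H ⊗[k] N.carrier) (f.lTensor H x) =
      (f.lTensor H).rTensor C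
        (RightComodule.coact (k := k) (C := C) (M := H ⊗[k] M.carrier) x)
    induction (show H ⊗[k] M.carrier from x) with
    | zero => simp
    | add x y hx hy => simp only [map_add, hx, hy]
    | tmul g m =>
      rw [LinearMap.lTensor_tmul, induced_rightCoact_tmul, induced_rightCoact_tmul, hf.2]
      generalize comul (R := k) g = t
      generalize RightComodule.coact (k := k) (C := C) m = u
      induction t with
      | zero => simp
      | add x y hx hy => simp only [map_add, LinearMap.add_apply, hx, hy]
      | tmul a b =>
        induction u with
        | zero => simp
        | add x y hx hy => simp only [map_add, hx, hy]
        | tmul n c => simp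

/-- Since 1 ⊗ m is coinvariant, so is φ(1 ⊗ m), and cofreeness identifies it with 1 ⊗ f(m). The
linearity and colinearity of f are those of φ at 1 ⊗ m, pushed through ε ⊗ id. -/
theorem exists_eq_lTensor {M N : YDModule k H C}
    {φ : H ⊗[k] M.carrier →ₗ[k] H ⊗[k] N.carrier}
    (hφ : φ ∈ HopfBimodule.homs (induced M) (induced N)) :
    ∃ f ∈ YDModule.homs M N, f.lTensor H = φ := by
  obtain ⟨h1, h2, h3, h4⟩ := hφ
  replace h1 : ∀ (h : H) (x : H ⊗[k] M.carrier), φ (h • x) = h • φ x := h1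
  replace h2 : ∀ (h : H) (x : H ⊗[k] M.carrier),
    φ (MulOpposite.op h • x) = MulOpposite.op h • φ x := h2
  replace h3 : ∀ x : H ⊗[k] M.carrier, LeftComodule.coact (k := k) (C := H) (φ x) =
    φ.lTensor H (LeftComodule.coact (k := k) (C := H) x) := h3
  replace h4 : ∀ x : H ⊗[k] M.carrier, RightComodule.coact (k := k) (C := C) (φ x) =
    φ.rTensor C (RightComodule.coact (k := k) (C := C) x) := h4
  let f : M.carrier →ₗ[k] N.carrier :=
    counitMap k H N.carrier ∘ₗ φ ∘ₗ TensorProduct.mk k H M.carrier 1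
  have hone : ∀ m, φ (1 ⊗ₜ m) = 1 ⊗ₜ f m := fun m => by
    rw [← lTensor_counitMap_leftCoact k H N.carrier (φ (1 ⊗ₜ m)), h3, induced_leftCoact_tmul]
    simp [f, Algebra.TensorProduct.one_def]
  have hf : f.lTensor H = φ := by
    ext g m
    have := h1 g (1 ⊗ₜ m)
    rw [hone, smul_tmul', smul_tmul', smul_eq_mul, mul_one] at this
    simp [this]
  have hcounit : ∀ x, counitMap k H N.carrier (f.lTensor H x) =
      f (counitMap k H M.carrier x) := fun x => by
    induction x with
    | zero => simp
    | add x y hx hy => simp only [map_add, hx, hy]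
    | tmul g m => simp
  refine ⟨f, ⟨fun h m => ?_, fun m => ?_⟩, hf⟩
  · have := congrArg (counitMap k H N.carrier) (h2 h (1 ⊗ₜ m))
    rw [counitMap_op_smul, ← hf, hcounit, hcounit, counitMap_op_smul] at this
    simpa using this
  · have := congrArg ((counitMap k H N.carrier).rTensor C) (h4 (1 ⊗ₜ m))
    rw [hone, rTensor_counitMap_rightCoact_one_tmul, ← LinearMap.rTensor_comp_apply,
      ← hf, show counitMap k H N.carrier ∘ₗ f.lTensor H = f ∘ₗ counitMap k H M.carrier from
        LinearMap.ext hcounit, LinearMap.rTensor_comp_apply,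
      rTensor_counitMap_rightCoact_one_tmul] at this
    exact this

variable (k H C) in
/-- The functor `M ↦ H ⊗ M` from Yetter–Drinfeld modules to Hopf bimodules. -/
def inducedFunctor : YDModule k H C ⥤ HopfBimodule k H C where
  obj := induced
  map f := ⟨f.1.lTensor H, lTensor_mem_homs f.2⟩
  map_id M := Subtype.ext (LinearMap.lTensor_id H M.carrier)
  map_comp f g := Subtype.ext (LinearMap.lTensor_comp H g.1 f.1)

instance : (inducedFunctor k H C).Additive where
  map_add {_ _ f g} := Subtype.ext (LinearMap.lTensor_add H f.1 g.1)

instance : (inducedFunctor k H C).Linear k where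
  map_smul f r := Subtype.ext (LinearMap.lTensor_smul H r f.1)

instance : (inducedFunctor k H C).Full where
  map_surjective φ := by
    obtain ⟨f, hf, h⟩ := exists_eq_lTensor φ.2
    exact ⟨⟨f, hf⟩, Subtype.ext h⟩

instance : (inducedFunctor k H C).Faithful where
  map_injective {M N f g} h := by
    have h' : f.1.lTensor H = g.1.lTensor H := congrArg Subtype.val h
    refine Subtype.ext (LinearMap.ext fun m => ?_)
    simpa using congrArg (counitMap k H N.carrier) (LinearMap.congr_fun h' (1 ⊗ₜ m))

end Functor

end Induced

/-! ### Left coinvariants and the fundamental theorem of Hopf modules -/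

section Coinvariants

variable {k H C : Type u} [Field k] [Ring H] [HopfAlgebra k H]
  [AddCommGroup C] [Module k C] [Coalgebra k C] [Module H C] [IsScalarTower k H C]
  [Module Hᵐᵒᵖ C] [IsScalarTower k Hᵐᵒᵖ C] (M : HopfBimodule k H C)

namespace HopfBimodule

theorem assoc_comul_leftCoact (m : M.carrier) :
    TensorProduct.assoc k H H M.carrier ((comul (R := k)).rTensor M.carrier
      (LeftComodule.coact (k := k) (C := H) m)) =
    (LeftComodule.coact (k := k) (C := H)).lTensor H (LeftComodule.coact (k := k) (C := H) m) :=
  LinearMap.congr_fun (LeftComodule.coassoc (k := k) (C := H)) m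

theorem lid_counit_leftCoact (m : M.carrier) :
    TensorProduct.lid k M.carrier ((counit (R := k)).rTensor M.carrier
      (LeftComodule.coact (k := k) (C := H) m)) = m :=
  LinearMap.congr_fun (LeftComodule.counit (k := k) (C := H)) m

theorem assoc_coact_rightCoact (m : M.carrier) :
    TensorProduct.assoc k M.carrier C C ((RightComodule.coact (k := k) (C := C)).rTensor C
      (RightComodule.coact (k := k) (C := C) m)) =
    (comul (R := k)).lTensor M.carrier (RightComodule.coact (k := k) (C := C) m) :=
  LinearMap.congr_fun (RightComodule.coassoc (k := k) (C := C)) m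

theorem rid_counit_rightCoact (m : M.carrier) :
    TensorProduct.rid k M.carrier ((counit (R := k)).lTensor M.carrier
      (RightComodule.coact (k := k) (C := C) m)) = m :=
  LinearMap.congr_fun (RightComodule.counit (k := k) (C := C)) m

/-- The left action as a map `H ⊗ M → M`. -/
def action : H ⊗[k] M.carrier →ₗ[k] M.carrier := TensorProduct.lift (lact k H M.carrier)

@[simp]
theorem action_tmul (h : H) (m : M.carrier) : M.action (h ⊗ₜ m) = h • m := rfl

/-- The projection `m ↦ S(m₍₋₁₎) m₍₀₎` onto the left coinvariants. -/
def proj : M.carrier →ₗ[k] M.carrier :=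
  M.action ∘ₗ (antipode k (A := H)).rTensor M.carrier ∘ₗ LeftComodule.coact (k := k) (C := H)

theorem proj_apply (m : M.carrier) : M.proj m =
    M.action ((antipode k (A := H)).rTensor M.carrier
      (LeftComodule.coact (k := k) (C := H) m)) := rfl

/-- By coassociativity the left side is m₍₋₂₎ S(m₍₋₁₎) m₍₀₎, which collapses by h₍₁₎ S(h₍₂₎) = ε(h).
-/
theorem action_lTensor_proj_leftCoact (m : M.carrier) :
    M.action (M.proj.lTensor H (LeftComodule.coact (k := k) (C := H) m)) = m := by
  let B : H ⊗[k] (H ⊗[k] M.carrier) →ₗ[k] M.carrier :=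
    M.action ∘ₗ (M.action ∘ₗ (antipode k (A := H)).rTensor M.carrier).lTensor H
  have key : ∀ t : H ⊗[k] M.carrier,
      B (TensorProduct.assoc k H H M.carrier ((comul (R := k)).rTensor M.carrier t)) =
      TensorProduct.lid k M.carrier ((counit (R := k)).rTensor M.carrier t) := by
    intro t
    induction t with
    | zero => simp
    | add x y hx hy => simp only [map_add, hx, hy]
    | tmul a n =>
      have hB : ∀ s : H ⊗[k] H, B (TensorProduct.assoc k H H M.carrier (s ⊗ₜ n)) =
          LinearMap.mul' k H ((antipode k).lTensor H s) • n := by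
        intro s
        induction s with
        | zero => simp
        | add x y hx hy => simp only [map_add, add_tmul, add_smul, hx, hy]
        | tmul b c => simp [B, mul_smul]
      simp [hB]
  have h1 := key (LeftComodule.coact (k := k) (C := H) m)
  rw [assoc_comul_leftCoact, lid_counit_leftCoact] at h1
  refine Eq.trans ?_ h1
  simp only [B, LinearMap.comp_apply, ← LinearMap.lTensor_comp_apply]
  rfl

theorem map₂_lact_mul {N : Type*} [AddCommGroup N] [Module k N] [Module H N]
    [IsScalarTower k H N] (s t : H ⊗[k] H) (x : H ⊗[k] N) :
    TensorProduct.map₂ (lact k H H) (lact k H N) (s * t) x =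
      TensorProduct.map₂ (lact k H H) (lact k H N) s
        (TensorProduct.map₂ (lact k H H) (lact k H N) t x) := by
  induction s with
  | zero => simp
  | add x y hx hy => simp only [map_add, LinearMap.add_apply, add_mul, hx, hy]
  | tmul a b =>
    induction t with
    | zero => simp
    | add x y hx hy => simp only [map_add, LinearMap.add_apply, mul_add, hx, hy]
    | tmul c d =>
      induction x with
      | zero => simp
      | add x y hx hy => simp only [map_add, hx, hy]
      | tmul h n => simp [mul_smul, mul_assoc]

/-- A formula for Δ ∘ S is avoided. As n = n₍₋₁₎ p(n₍₀₎), the coaction of n is Δ(n₍₋₁₎)(1 ⊗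
p(n₍₀₎)). Hence that of p(m) is Δ(S(m₍₋₂₎) m₍₋₁₎)(1 ⊗ p(m₍₀₎)) = 1 ⊗ p(m). -/
theorem leftCoact_proj (m : M.carrier) :
    LeftComodule.coact (k := k) (C := H) (M.proj m) = 1 ⊗ₜ M.proj m := by
  let A : H ⊗[k] H →ₗ[k] H ⊗[k] M.carrier →ₗ[k] H ⊗[k] M.carrier :=
    TensorProduct.map₂ (lact k H H) (lact k H M.carrier)
  let G : H ⊗[k] M.carrier →ₗ[k] H ⊗[k] M.carrier := TensorProduct.lift
    (A.compl₁₂ (comul (R := k) (A := H)) (TensorProduct.mk k H M.carrier 1 ∘ₗ M.proj))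
  have hG : ∀ n : M.carrier, G (LeftComodule.coact (k := k) (C := H) n) =
      LeftComodule.coact (k := k) (C := H) n := by
    intro n
    have key : ∀ t : H ⊗[k] M.carrier, G t = (M.action ∘ₗ M.proj.lTensor H).lTensor H
        (TensorProduct.assoc k H H M.carrier ((comul (R := k)).rTensor M.carrier t)) := by
      intro t
      induction t with
      | zero => simp
      | add x y hx hy => simp only [map_add, hx, hy]
      | tmul b n =>
        simp only [G, lift.tmul, LinearMap.compl₁₂_apply, LinearMap.rTensor_tmul]
        generalize comul (R := k) b = s
        induction s with
        | zero => simp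
        | add x y hx hy => simp only [map_add, LinearMap.add_apply, add_tmul, hx, hy]
        | tmul c d => simp [A]
    have hid : (M.action ∘ₗ M.proj.lTensor H) ∘ₗ LeftComodule.coact (k := k) (C := H) =
        LinearMap.id := LinearMap.ext M.action_lTensor_proj_leftCoact
    rw [key, assoc_comul_leftCoact, ← LinearMap.lTensor_comp_apply, hid, LinearMap.lTensor_id,
      LinearMap.id_apply]
  -- E(a ⊗ b ⊗ n) = Δ(S(a)) Δ(b) (1 ⊗ p(n)).
  let E : H ⊗[k] (H ⊗[k] M.carrier) →ₗ[k] H ⊗[k] M.carrier := TensorProduct.lift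
    (A.compl₁₂ (comul (R := k) (A := H) ∘ₗ antipode k) G)
  have key : ∀ t : H ⊗[k] M.carrier,
      E (TensorProduct.assoc k H H M.carrier ((comul (R := k)).rTensor M.carrier t)) =
      1 ⊗ₜ M.proj (TensorProduct.lid k M.carrier ((counit (R := k)).rTensor M.carrier t)) := by
    intro t
    induction t with
    | zero => simp
    | add x y hx hy => simp only [map_add, tmul_add, hx, hy]
    | tmul a n =>
      have hE : ∀ s : H ⊗[k] H, E (TensorProduct.assoc k H H M.carrier (s ⊗ₜ n)) =
          A (comul (LinearMap.mul' k H ((antipode k).rTensor H s))) (1 ⊗ₜ M.proj n) := by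
        intro s
        induction s with
        | zero => simp
        | add x y hx hy => simp only [map_add, LinearMap.add_apply, add_tmul, hx, hy]
        | tmul b c => simp [E, G, A, map₂_lact_mul]
      rw [LinearMap.rTensor_tmul, hE, mul_antipode_rTensor_comul_apply,
        Algebra.algebraMap_eq_smul_one, map_smul, Bialgebra.comul_one,
        Algebra.TensorProduct.one_def]
      simp [A]
  have key' : ∀ t : H ⊗[k] M.carrier,
      E ((LeftComodule.coact (k := k) (C := H)).lTensor H t) =
      LeftComodule.coact (k := k) (C := H)
        (M.action ((antipode k (A := H)).rTensor M.carrier t)) := by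
    intro t
    induction t with
    | zero => simp
    | add x y hx hy => simp only [map_add, hx, hy]
    | tmul a n => simp [E, A, hG, M.leftCoact_smul]
  rw [proj_apply, ← key', ← assoc_comul_leftCoact, key, lid_counit_leftCoact]
  rfl

/-- The left coinvariants of a Hopf bimodule. -/
def coinvariants : Submodule k M.carrier :=
  LinearMap.eqLocus (LeftComodule.coact (k := k) (C := H)) (TensorProduct.mk k H M.carrier 1)

theorem leftCoact_coe (v : M.coinvariants) :
    LeftComodule.coact (k := k) (C := H) (v : M.carrier) = 1 ⊗ₜ (v : M.carrier) := v.2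

theorem leftCoact_smul_coe (h : H) (v : M.coinvariants) :
    LeftComodule.coact (k := k) (C := H) (h • (v : M.carrier)) =
      ((lact k H M.carrier).flip v).lTensor H (comul (R := k) h) := by
  rw [M.leftCoact_smul, leftCoact_coe]
  generalize comul (R := k) h = t
  induction t with
  | zero => simp
  | add x y hx hy => simp only [map_add, LinearMap.add_apply, hx, hy]
  | tmul a b => simp

theorem leftCoact_op_smul_coe (h : H) (v : M.coinvariants) :
    LeftComodule.coact (k := k) (C := H) (MulOpposite.op h • (v : M.carrier)) =
      ((ract k H M.carrier).flip v).lTensor H (comul (R := k) h) := by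
  rw [M.leftCoact_op_smul, leftCoact_coe]
  generalize comul (R := k) h = t
  induction t with
  | zero => simp
  | add x y hx hy => simp only [map_add, LinearMap.add_apply, hx, hy]
  | tmul a b => simp

/-- The coaction of h v is h₍₁₎ ⊗ h₍₂₎ v, so the projection is S(h₍₁₎) h₍₂₎ v. -/
theorem proj_smul_coe (h : H) (v : M.coinvariants) :
    M.proj (h • (v : M.carrier)) = counit (R := k) h • (v : M.carrier) := by
  rw [proj_apply, leftCoact_smul_coe]
  have key : ∀ t : H ⊗[k] H, M.action ((antipode k (A := H)).rTensor M.carrier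
      (((lact k H M.carrier).flip v).lTensor H t)) =
      LinearMap.mul' k H ((antipode k).rTensor H t) • (v : M.carrier) := by
    intro t
    induction t with
    | zero => simp
    | add x y hx hy => simp only [map_add, add_smul, hx, hy]
    | tmul a b => simp [mul_smul]
  simp [key]

theorem proj_coe (v : M.coinvariants) : M.proj (v : M.carrier) = v := by
  simpa using M.proj_smul_coe 1 v

/-- The projection onto the left coinvariants. -/
def toCoinvariants : M.carrier →ₗ[k] M.coinvariants :=
  M.proj.codRestrict M.coinvariants M.leftCoact_proj

@[simp]
theorem coe_toCoinvariants (m : M.carrier) : (M.toCoinvariants m : M.carrier) = M.proj m := rfl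

@[simp]
theorem toCoinvariants_coe (v : M.coinvariants) : M.toCoinvariants (v : M.carrier) = v :=
  Subtype.ext (M.proj_coe v)

theorem toCoinvariants_smul_coe (h : H) (v : M.coinvariants) :
    M.toCoinvariants (h • (v : M.carrier)) = counit (R := k) h • v :=
  Subtype.ext (M.proj_smul_coe h v)

/-- Write m = m₍₋₁₎ p(m₍₀₎). The right action commutes with m₍₋₁₎, and p turns a left factor a into
ε(a). This yields associativity of the adjoint action without antimultiplicativity of S. -/
theorem proj_op_smul_proj (h : Hᵐᵒᵖ) (m : M.carrier) :
    M.proj (h • M.proj m) = M.proj (h • m) := by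
  have key : ∀ t : H ⊗[k] M.carrier, M.proj (h • M.action (M.proj.lTensor H t)) =
      M.proj (h • M.proj (TensorProduct.lid k M.carrier
        ((counit (R := k)).rTensor M.carrier t))) := by
    intro t
    induction t with
    | zero => simp
    | add x y hx hy => simp only [map_add, smul_add, hx, hy]
    | tmul a n =>
      have hn : ∀ n : M.carrier, M.proj (a • n) = counit (R := k) a • M.proj n := by
        intro n
        have key : ∀ t : H ⊗[k] M.carrier, M.proj (a • M.action (M.proj.lTensor H t)) =
            counit (R := k) a • M.proj (M.action (M.proj.lTensor H t)) := by
          intro t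
          induction t with
          | zero => simp
          | add x y hx hy => simp only [map_add, smul_add, hx, hy]
          | tmul b n =>
            have := fun h => M.proj_smul_coe h (M.toCoinvariants n)
            simp only [coe_toCoinvariants] at this
            simp [← mul_smul, this]
        simpa [action_lTensor_proj_leftCoact] using key (LeftComodule.coact (k := k) (C := H) n)
      simp [← smul_comm a h, hn, smul_comm h (counit (R := k) a)]
  have := key (LeftComodule.coact (k := k) (C := H) m)
  rw [action_lTensor_proj_leftCoact, lid_counit_leftCoact] at this
  exact this.symm

/-- The right adjoint action `v ↦ S(h₍₁₎) v h₍₂₎` on the coinvariants. -/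
instance : Module Hᵐᵒᵖ M.coinvariants where
  smul h v := M.toCoinvariants (h • (v : M.carrier))
  one_smul v := by
    change M.toCoinvariants ((1 : Hᵐᵒᵖ) • (v : M.carrier)) = v
    simp
  mul_smul a b v := by
    refine Subtype.ext ?_
    change M.proj ((a * b) • (v : M.carrier)) = M.proj (a • M.proj (b • (v : M.carrier)))
    rw [proj_op_smul_proj, mul_smul]
  smul_zero h := by
    change M.toCoinvariants (h • (0 : M.carrier)) = 0
    simp
  smul_add h v w := by
    change M.toCoinvariants (h • ((v : M.carrier) + (w : M.carrier))) = _
    rw [smul_add, map_add]; rfl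
  add_smul a b v := by
    change M.toCoinvariants ((a + b) • (v : M.carrier)) = _
    rw [add_smul, map_add]; rfl
  zero_smul v := by
    change M.toCoinvariants ((0 : Hᵐᵒᵖ) • (v : M.carrier)) = 0
    simp

theorem coinvariants_op_smul (h : Hᵐᵒᵖ) (v : M.coinvariants) :
    h • v = M.toCoinvariants (h • (v : M.carrier)) := rfl

instance : IsScalarTower k Hᵐᵒᵖ M.coinvariants where
  smul_assoc r h v := by
    rw [coinvariants_op_smul, coinvariants_op_smul, smul_assoc, map_smul]

/-- The coaction of v h is h₍₁₎ ⊗ v h₍₂₎, so decomposing v h as in `action_lTensor_proj_leftCoact`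
gives h₍₁₎ p(v h₍₂₎). -/
theorem op_smul_coe (h : H) (v : M.coinvariants) :
    M.action ((M.coinvariants.subtype ∘ₗ (ract k H M.coinvariants).flip v).lTensor H
      (comul (R := k) h)) = MulOpposite.op h • (v : M.carrier) := by
  rw [← M.action_lTensor_proj_leftCoact (MulOpposite.op h • (v : M.carrier)),
    leftCoact_op_smul_coe, ← LinearMap.lTensor_comp_apply]
  rfl

/-- Commutation of the two coactions makes the M-leg of v₍₀₎ ⊗ v₍₁₎ coinvariant, so p fixes it. The
C-coaction therefore restricts to the coinvariants. -/
theorem rTensor_proj_rightCoact_coe (v : M.coinvariants) :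
    M.proj.rTensor C (RightComodule.coact (k := k) (C := C) (v : M.carrier)) =
      RightComodule.coact (k := k) (C := C) (v : M.carrier) := by
  have h1 := LinearMap.congr_fun M.coact_comm (v : M.carrier)
  simp only [LinearMap.comp_apply, leftCoact_coe, LinearMap.lTensor_tmul,
    LinearEquiv.coe_coe] at h1
  rw [← LinearEquiv.eq_symm_apply] at h1
  rw [proj, ← LinearMap.comp_assoc, LinearMap.rTensor_comp_apply, h1]
  generalize RightComodule.coact (k := k) (C := C) (v : M.carrier) = u
  induction u with
  | zero => simp
  | add x y hx hy => simp only [map_add, tmul_add, hx, hy]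
  | tmul m c => simp

/-- The right `C`-coaction on the coinvariants. -/
def coinvariantsCoact : M.coinvariants →ₗ[k] M.coinvariants ⊗[k] C :=
  M.toCoinvariants.rTensor C ∘ₗ RightComodule.coact (k := k) (C := C) ∘ₗ M.coinvariants.subtype

theorem rTensor_subtype_coinvariantsCoact (v : M.coinvariants) :
    M.coinvariants.subtype.rTensor C (M.coinvariantsCoact v) =
      RightComodule.coact (k := k) (C := C) (v : M.carrier) := by
  rw [← rTensor_proj_rightCoact_coe, coinvariantsCoact, LinearMap.comp_apply,
    ← LinearMap.rTensor_comp_apply]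
  rfl

/-- The inclusion is split by `toCoinvariants`. Comodule identities for the coinvariants can thus be
checked in M. -/
theorem rTensor_subtype_injective (D : Type*) [AddCommGroup D] [Module k D] :
    Function.Injective (M.coinvariants.subtype.rTensor D) := by
  refine Function.LeftInverse.injective (g := M.toCoinvariants.rTensor D) fun x => ?_
  rw [← LinearMap.rTensor_comp_apply, show M.toCoinvariants ∘ₗ M.coinvariants.subtype =
    LinearMap.id from LinearMap.ext M.toCoinvariants_coe, LinearMap.rTensor_id,
    LinearMap.id_apply]

instance : RightComodule k C M.coinvariants where
  coact := M.coinvariantsCoact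
  coassoc := by
    refine LinearMap.ext fun v => M.rTensor_subtype_injective (C ⊗[k] C) ?_
    have key : ∀ t : (M.coinvariants ⊗[k] C) ⊗[k] C,
        M.coinvariants.subtype.rTensor (C ⊗[k] C)
          (TensorProduct.assoc k M.coinvariants C C t) =
        TensorProduct.assoc k M.carrier C C
          ((M.coinvariants.subtype.rTensor C).rTensor C t) := by
      intro t
      induction t with
      | zero => simp
      | add x y hx hy => simp only [map_add, hx, hy]
      | tmul x c =>
        induction x with
        | zero => simp
        | add x y hx hy => simp only [map_add, add_tmul, hx, hy]
        | tmul v d => simp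
    have hρ : M.coinvariants.subtype.rTensor C ∘ₗ M.coinvariantsCoact =
        RightComodule.coact (k := k) (C := C) ∘ₗ M.coinvariants.subtype :=
      LinearMap.ext M.rTensor_subtype_coinvariantsCoact
    have hΔ : ∀ u : M.coinvariants ⊗[k] C,
        M.coinvariants.subtype.rTensor (C ⊗[k] C)
          ((comul (R := k)).lTensor M.coinvariants u) =
        (comul (R := k)).lTensor M.carrier (M.coinvariants.subtype.rTensor C u) := by
      intro u
      induction u with
      | zero => simp
      | add x y hx hy => simp only [map_add, hx, hy]
      | tmul v c => simp
    simp only [LinearMap.comp_apply, LinearEquiv.coe_coe]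
    rw [key, ← LinearMap.rTensor_comp_apply, hρ, LinearMap.rTensor_comp_apply, hΔ,
      rTensor_subtype_coinvariantsCoact, assoc_coact_rightCoact]
  counit := by
    refine LinearMap.ext fun v => Subtype.ext ?_
    have key : ∀ u : M.coinvariants ⊗[k] C,
        (TensorProduct.rid k M.coinvariants ((counit (R := k)).lTensor M.coinvariants u) :
          M.carrier) =
        TensorProduct.rid k M.carrier ((counit (R := k)).lTensor M.carrier
          (M.coinvariants.subtype.rTensor C u)) := by
      intro u
      induction u with
      | zero => simp
      | add x y hx hy => simp only [map_add, Submodule.coe_add, hx, hy]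
      | tmul v c => simp
    simp only [LinearMap.comp_apply, LinearEquiv.coe_coe]
    rw [key, rTensor_subtype_coinvariantsCoact, rid_counit_rightCoact]
    rfl

theorem rTensor_subtype_rightCoact (v : M.coinvariants) :
    M.coinvariants.subtype.rTensor C (RightComodule.coact (k := k) (C := C) v) =
      RightComodule.coact (k := k) (C := C) (v : M.carrier) :=
  M.rTensor_subtype_coinvariantsCoact v

/-- The two sides compute (p ⊗ id) of the C-coaction of v h. Writing v h = h₍₁₎ p(v h₍₂₎) and using
left linearity gives the left side, as p absorbs the factor acting on M; right linearity gives the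
right side. -/
theorem coinvariants_yetterDrinfeld (v : M.coinvariants) (h : H) :
    ydMap k H C M.coinvariants v (comul (R := k) h) =
      TensorProduct.map₂ (ract k H M.coinvariants) (ract k H C)
        (comul (R := k) h) (RightComodule.coact (k := k) (C := C) v) := by
  have left : ∀ t : H ⊗[k] H, ydMap k H C M.coinvariants v t =
      M.toCoinvariants.rTensor C (RightComodule.coact (k := k) (C := C) (M.action
        ((M.coinvariants.subtype ∘ₗ (ract k H M.coinvariants).flip v).lTensor H t))) := by
    intro t
    induction t with
    | zero => simp
    | add x y hx hy => simp only [map_add, hx, hy]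
    | tmul a b =>
      have key : ∀ (s : H ⊗[k] H) (u : M.coinvariants ⊗[k] C),
          M.toCoinvariants.rTensor C (TensorProduct.map₂ (lact k H M.carrier) (lact k H C) s
            (M.coinvariants.subtype.rTensor C u)) =
          (lact k H C (TensorProduct.lid k H (counit.rTensor H s))).lTensor _ u := by
        intro s u
        induction s with
        | zero => simp
        | add x y hx hy =>
          simp only [map_add, LinearMap.add_apply, LinearMap.lTensor_add, hx, hy]
        | tmul c d =>
          induction u with
          | zero => simp
          | add x y hx hy => simp only [map_add, hx, hy]
          | tmul w e => simp [toCoinvariants_smul_coe, smul_tmul]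
      simp only [LinearMap.lTensor_tmul, action_tmul, M.rightCoact_smul, LinearMap.comp_apply,
        Submodule.subtype_apply]
      rw [← rTensor_subtype_rightCoact, key, rTensor_counit_comul]
      simp [ydMap]
  have right : ∀ (t : H ⊗[k] H) (u : M.coinvariants ⊗[k] C),
      TensorProduct.map₂ (ract k H M.coinvariants) (ract k H C) t u =
      M.toCoinvariants.rTensor C (TensorProduct.map₂ (ract k H M.carrier) (ract k H C) t
        (M.coinvariants.subtype.rTensor C u)) := by
    intro t u
    induction t with
    | zero => simp
    | add x y hx hy => simp only [map_add, LinearMap.add_apply, hx, hy]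
    | tmul a b =>
      induction u with
      | zero => simp
      | add x y hx hy => simp only [map_add, hx, hy]
      | tmul w e => simp [coinvariants_op_smul]
  rw [left, op_smul_coe, M.rightCoact_op_smul, right, rTensor_subtype_rightCoact]

/-- The Yetter–Drinfeld module of left coinvariants of a Hopf bimodule. -/
def coinvariantsYD : YDModule k H C where
  carrier := M.coinvariants
  yetterDrinfeld := M.coinvariants_yetterDrinfeld

/-- The isomorphism `h ⊗ v ↦ h v` from `H ⊗ Mᶜᵒᴴ` to `M`. -/
def coinvariantsEquiv : H ⊗[k] M.coinvariants ≃ₗ[k] M.carrier :=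
  LinearEquiv.ofLinearMap (M.action ∘ₗ M.coinvariants.subtype.lTensor H)
    (M.toCoinvariants.lTensor H ∘ₗ LeftComodule.coact (k := k) (C := H))
    (by
      refine LinearMap.ext fun m => ?_
      simp only [LinearMap.comp_apply, ← LinearMap.lTensor_comp_apply]
      exact M.action_lTensor_proj_leftCoact m)
    (by
      ext h v
      have key : ∀ t : H ⊗[k] H, M.toCoinvariants.lTensor H
          (((lact k H M.carrier).flip v).lTensor H t) =
          TensorProduct.rid k H (counit.lTensor H t) ⊗ₜ v := by
        intro t
        induction t with
        | zero => simp
        | add x y hx hy => simp only [map_add, add_tmul, hx, hy]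
        | tmul a b => simp [toCoinvariants_smul_coe, smul_tmul]
      simp [leftCoact_smul_coe, key])

@[simp]
theorem coinvariantsEquiv_tmul (h : H) (v : M.coinvariants) :
    M.coinvariantsEquiv (h ⊗ₜ v) = h • (v : M.carrier) := rfl

/-- Right linearity is the substantial point: it is v h = h₍₁₎ p(v h₍₂₎) multiplied by g on the
left. -/
theorem coinvariantsEquiv_mem_homs [BimoduleCoalgebra k H C] :
    M.coinvariantsEquiv.toLinearMap ∈ HopfBimodule.homs (induced M.coinvariantsYD) M := by
  refine ⟨fun h x => ?_, fun h x => ?_, fun x => ?_, fun x => ?_⟩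
  · change M.coinvariantsEquiv (h • (show H ⊗[k] M.coinvariants from x)) =
      h • M.coinvariantsEquiv x
    induction (show H ⊗[k] M.coinvariants from x) with
    | zero => simp
    | add x y hx hy => simp only [smul_add, map_add, hx, hy]
    | tmul g v => simp [smul_tmul', mul_smul]
  -- The local instances on H ⊗ M are out of scope here, so the diagonal action, and below the
  -- coactions, are unfolded by `change`.
  · change M.coinvariantsEquiv (TensorProduct.map₂ (ract k H H) (ract k H M.coinvariants)
      (comul h) x) = MulOpposite.op h • M.coinvariantsEquiv x
    induction (show H ⊗[k] M.coinvariants from x) with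
    | zero => simp
    | add x y hx hy => simp only [map_add, smul_add, hx, hy]
    | tmul g v =>
      rw [coinvariantsEquiv_tmul, ← smul_comm g, ← op_smul_coe]
      generalize comul (R := k) h = t
      induction t with
      | zero => simp
      | add x y hx hy => simp only [map_add, LinearMap.add_apply, smul_add, hx, hy]
      | tmul a b => simp [mul_smul]
  · change LeftComodule.coact (k := k) (C := H) (M.coinvariantsEquiv x) =
      M.coinvariantsEquiv.toLinearMap.lTensor H (TensorProduct.assoc k H H M.coinvariants
        ((comul (R := k)).rTensor M.coinvariants x))
    induction (show H ⊗[k] M.coinvariants from x) with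
    | zero => simp
    | add x y hx hy => simp only [map_add, hx, hy]
    | tmul g v =>
      rw [coinvariantsEquiv_tmul, leftCoact_smul_coe, LinearMap.rTensor_tmul]
      generalize comul (R := k) g = t
      induction t with
      | zero => simp
      | add x y hx hy => simp only [map_add, add_tmul, hx, hy]
      | tmul a b => simp
  · change RightComodule.coact (k := k) (C := C) (M.coinvariantsEquiv x) =
      M.coinvariantsEquiv.toLinearMap.rTensor C (inducedRightCoact k H C M.coinvariants x)
    induction (show H ⊗[k] M.coinvariants from x) with
    | zero => simp
    | add x y hx hy => simp only [map_add, hx, hy]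
    | tmul g v =>
      rw [coinvariantsEquiv_tmul, M.rightCoact_smul, inducedRightCoact_tmul,
        ← rTensor_subtype_rightCoact]
      generalize comul (R := k) g = t
      generalize RightComodule.coact (k := k) (C := C) v = u
      induction t with
      | zero => simp
      | add x y hx hy => simp only [map_add, LinearMap.add_apply, hx, hy]
      | tmul a b =>
        induction u with
        | zero => simp
        | add x y hx hy => simp only [map_add, hx, hy]
        | tmul w c => simp

theorem symm_mem_homs {M N : HopfBimodule k H C} (e : M.carrier ≃ₗ[k] N.carrier)
    (he : e.toLinearMap ∈ HopfBimodule.homs M N) :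
    e.symm.toLinearMap ∈ HopfBimodule.homs N M := by
  have hcomp : e.symm.toLinearMap ∘ₗ e.toLinearMap = LinearMap.id := e.symm_comp
  refine ⟨fun h x => e.injective ?_, fun h x => e.injective ?_, fun x => ?_, fun x => ?_⟩
  · simpa using (he.1 h (e.symm x)).symm
  · simpa using (he.2.1 h (e.symm x)).symm
  · have := congrArg (e.symm.toLinearMap.lTensor H) (he.2.2.1 (e.symm x))
    rw [← LinearMap.lTensor_comp_apply, hcomp] at this
    simpa using this.symm
  · have := congrArg (e.symm.toLinearMap.rTensor C) (he.2.2.2 (e.symm x))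
    rw [← LinearMap.rTensor_comp_apply, hcomp] at this
    simpa using this.symm

end HopfBimodule

instance [BimoduleCoalgebra k H C] : (inducedFunctor k H C).EssSurj where
  mem_essImage M := ⟨M.coinvariantsYD, ⟨{
    hom := ⟨_, M.coinvariantsEquiv_mem_homs⟩
    inv := ⟨_, HopfBimodule.symm_mem_homs (M := induced M.coinvariantsYD) M.coinvariantsEquiv
      M.coinvariantsEquiv_mem_homs⟩
    hom_inv_id := Subtype.ext M.coinvariantsEquiv.symm_comp
    inv_hom_id := Subtype.ext M.coinvariantsEquiv.comp_symm }⟩⟩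

instance [BimoduleCoalgebra k H C] : (inducedFunctor k H C).IsEquivalence where

end Coinvariants

end HopfYD

theorem mainTheorem9 (k H C : Type u) [Field k] [Ring H] [HopfAlgebra k H]
    [AddCommGroup C] [Module k C] [Coalgebra k C]
    [Module H C] [IsScalarTower k H C] [Module Hᵐᵒᵖ C] [IsScalarTower k Hᵐᵒᵖ C]
    [HopfYD.BimoduleCoalgebra k H C] :
    ∃ e : HopfYD.YDModule k H C ≌ HopfYD.HopfBimodule k H C,
      e.functor.Additive ∧ e.functor.Linear k :=
  -- The functor of this equivalence is `inducedFunctor` by definition, so its instances transfer.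
  ⟨(HopfYD.inducedFunctor k H C).asEquivalence,
    inferInstanceAs (HopfYD.inducedFunctor k H C).Additive,
    inferInstanceAs ((HopfYD.inducedFunctor k H C).Linear k)⟩
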